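/- A stochastic shortest path instance consists of: a finite set of states, namely a target state $0$ and non-target states $1,\dots,n$; a finite set of actions, namely an action $0$ and actions $1,\dots,m$; a $0/1$ matrix $J\in\{0,1\}^{m\times n}$, where $J(a,i)=1$ iff action $a$ is available in state $i$, such that every action $a\in\{1,\dots,m\}$ is available in exactly one state; a matrix $P\in\mathbb{R}_{\ge 0}^{m\times n}$ with row sums at most $1$, where $P(a,i)$ is the probability of moving to state $i$ when taking action $a$, the remaining probability $1-\sum_i P(a,i)$ being that of moving to the target; and a cost vector $c\in\mathbb{R}^m$. In the target only action $0$ is available; it has no cost and leads back to the target with probability $1$. The support graph is the bipartite directed graph on states and actions with an arc from each state to each action available in it and from each action to each state to which it leads with positive probability. A policy $\Pi$ assigns to each period $k\ge 0$ and each walk $w=(s_0,a_0,s_1,\dots,a_{k-1},s_k)$ in the support graph (the history) a row stochastic $n\times m$ matrix $\Pi_{k,w}$ with $\Pi_{k,w}(i,a)>0$ only if $J(a,i)=1$; $\Pi_{k,w}(i,a)$ is the probability of choosing action $a$ in state $i$ in period $k$ after history $w$. The policy is deterministic if all its matrices are $0/1$ matrices, and stationary if $\Pi_{k,w}$ does not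 depend on $(k,w)$. For a non-target state $s$, let $x_k^\Pi\in\mathbb{R}_{\ge 0}^m$ be the vector of the probabilities that action $a$ is performed in period $k$ when starting in $s$ and following $\Pi$. The policy is $s$-proper if $\sum_{k\ge 0}x_k^\Pi$ is finite, and its cost is then $c^T\sum_{k\ge 0}x_k^\Pi$. The $s$-SSP is the problem of finding an $s$-proper policy of minimal cost among all $s$-proper policies (in general history-dependent and randomized). Assume that every state has a directed path to the target in the support graph, and that no transition cycle has negative cost, i.e. $c^Tx\ge 0$ for every $x\ge 0$ with $(J-P)^Tx=0$. Then, for every non-target state $s$, the $s$-SSP admits an optimal policy that is $s$-proper, deterministic and stationary; it is optimal among all $s$-proper policies, history-dependent and randomized ones included. -/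

import Mathlib

/-- A stochastic shortest path instance. The states are `Option S`: the element `none` is the target
state `0`, and `S` is the finite set of the other states `1, …, n`. Likewise the actions are
`Option A`, where `none` is the unique action `0` available at the target, which leads back to the
target with probability one. -/
structure SSP (S A : Type*) [Fintype S] [Fintype A] where
  /-- `J a s = 1` iff action `a` is available in state `s`. -/
  J : Matrix A S ℝ
  /-- `P a s = p(s | a)`; the remaining mass `1 - ∑ s, P a s` goes to the target. -/
  P : Matrix A S ℝ
  /-- The cost of an action. -/
  c : A → ℝ
  J_zero_one : ∀ a s, J a s = 0 ∨ J a s = 1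
  J_unique : ∀ a, ∃! s, J a s = 1
  P_nonneg : ∀ a s, 0 ≤ P a s
  P_row_sum_le : ∀ a, ∑ s, P a s ≤ 1

namespace SSP

variable {S A : Type*} [Fintype S] [Fintype A]

/-- The transition probabilities `p(t | a)` on all states and actions, target included. -/
def trans (I : SSP S A) : Option A → Option S → ℝ
  | none, none => 1
  | none, some _ => 0
  | some a, some t => I.P a t
  | some a, none => 1 - ∑ t, I.P a t

/-- The arcs of the support graph, a bipartite directed graph on states (`Sum.inl`) and actions
(`Sum.inr`): from a state to each action available in it, and from an action to each state to which
it leads with positive probability. -/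
def Edge (I : SSP S A) : Option S ⊕ Option A → Option S ⊕ Option A → Prop
  | Sum.inl none, Sum.inr none => True
  | Sum.inl (some s), Sum.inr (some a) => I.J a s = 1
  | Sum.inr a, Sum.inl t => 0 < I.trans a t
  | _, _ => False

/-- There is a directed path in the support graph from every state to the target. -/
def EveryStateReachesTarget (I : SSP S A) : Prop :=
  ∀ i : S, Relation.ReflTransGen I.Edge (Sum.inl (some i)) (Sum.inl none)

/-- A transition cycle: a solution of `(J - P)ᵀ x = 0`, `x ≥ 0`. -/
def IsTransitionCycle (I : SSP S A) (x : A → ℝ) : Prop :=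
  Matrix.mulVec (Matrix.transpose (I.J - I.P)) x = 0 ∧ 0 ≤ x

/-- Every state has a path to the target and no transition cycle has negative cost. -/
def Assumption (I : SSP S A) : Prop :=
  I.EveryStateReachesTarget ∧ ¬ ∃ x : A → ℝ, I.IsTransitionCycle x ∧ dotProduct I.c x < 0

/-- A walk `(s₀, a₀, s₁, a₁, …, s_k)` of length `k` in the support graph, between states. -/
@[ext] structure Walk (I : SSP S A) (k : ℕ) where
  state : Fin (k + 1) → Option S
  action : Fin k → Option A
  edge_out : ∀ i : Fin k, I.Edge (Sum.inl (state i.castSucc)) (Sum.inr (action i))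
  edge_in : ∀ i : Fin k, I.Edge (Sum.inr (action i)) (Sum.inl (state i.succ))

/-- There are finitely many walks of a given length. -/
noncomputable instance (I : SSP S A) (k : ℕ) : Fintype (I.Walk k) :=
  have : Finite (I.Walk k) :=
    Finite.of_injective (fun w => (w.state, w.action)) fun _ _ h =>
      Walk.ext (congrArg Prod.fst h) (congrArg Prod.snd h)
  Fintype.ofFinite _

/-- The final state `s_k` of a walk of length `k`. -/
def Walk.last {I : SSP S A} {k : ℕ} (w : I.Walk k) : Option S := w.state (Fin.last k)

/-- The walk `(s₀, a₀, …, s_k)` obtained from `(s₀, a₀, …, s_k, a_k, s_{k+1})`. -/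
def Walk.init {I : SSP S A} {k : ℕ} (w : I.Walk (k + 1)) : I.Walk k where
  state i := w.state i.castSucc
  action i := w.action i.castSucc
  edge_out i := w.edge_out i.castSucc
  edge_in i := w.edge_in i.castSucc

/-- A policy (in general history-dependent and randomized): to each period `k` and each walk of
length `k` (the history so far) it assigns a row stochastic matrix indexed by (non-target) states and
actions, supported on available actions. -/
structure Policy (I : SSP S A) where
  toFun : (k : ℕ) → I.Walk k → Matrix S A ℝ
  nonneg : ∀ k w s a, 0 ≤ toFun k w s a
  row_sum : ∀ k w s, ∑ a, toFun k w s a = 1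
  available : ∀ k w s a, 0 < toFun k w s a → I.J a s = 1

namespace Policy

variable {I : SSP S A}

/-- All the matrices of the policy are 0/1 matrices. -/
def IsDeterministic (Q : I.Policy) : Prop :=
  ∀ k w s a, Q.toFun k w s a = 0 ∨ Q.toFun k w s a = 1

/-- The policy is constant: it depends neither on the period nor on the history. -/
def IsStationary (Q : I.Policy) : Prop :=
  ∃ M : Matrix S A ℝ, ∀ k w, Q.toFun k w = M

/-- The probability that the policy, after history `w`, chooses a given action in a given state;
in the target state it chooses the action `none`. -/
def choice (Q : I.Policy) {k : ℕ} (w : I.Walk k) : Option S → Option A → ℝ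
  | none, none => 1
  | some s, some a => Q.toFun k w s a
  | _, _ => 0

open Classical in
/-- The probability that the first `k` periods, starting in state `s` and following the policy, are
described by the walk `w` of length `k`. -/
noncomputable def walkProb (Q : I.Policy) (s : S) : {k : ℕ} → I.Walk k → ℝ
  | 0, w => if w.last = some s then 1 else 0
  | k + 1, w => walkProb Q s w.init
      * Q.choice w.init w.init.last (w.action (Fin.last k))
      * I.trans (w.action (Fin.last k)) w.last

/-- `x_k(a)`: the probability of performing action `a` in period `k`, starting in state `s`. -/
noncomputable def x (Q : I.Policy) (s : S) (k : ℕ) (a : A) : ℝ :=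
  ∑ w : I.Walk k, Q.walkProb s w * Q.choice w w.last (some a)

/-- The policy is `s`-proper: `∑ₖ x_k` is finite when starting in state `s`. -/
def IsProper (Q : I.Policy) (s : S) : Prop :=
  ∀ a, Summable fun k => Q.x s k a

/-- The flux vector `∑ₖ x_k`; meaningful for `s`-proper policies. -/
noncomputable def flux (Q : I.Policy) (s : S) (a : A) : ℝ :=
  ∑' k, Q.x s k a

/-- The cost `cᵀ ∑ₖ x_k`; meaningful for `s`-proper policies. -/
noncomputable def cost (Q : I.Policy) (s : S) : ℝ :=
  dotProduct I.c (Q.flux s)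

/-- An optimal solution of the `s`-SSP: an `s`-proper policy whose cost is minimal among all
`s`-proper policies, history-dependent and randomized ones included. -/
def IsOptimal (Q : I.Policy) (s : S) : Prop :=
  Q.IsProper s ∧ ∀ R : I.Policy, R.IsProper s → Q.cost s ≤ R.cost s

end Policy

end SSP

/-! The flux of an `s`-proper policy is a flow, i.e. a solution `y ≥ 0` of `(J - P)ᵀ y = e_s`
(`isFlow_flux`), so its cost is a linear function of a flow. It thus suffices to bound the cost of
every flow from below by that of an `s`-proper policy `ofFun f`, of which there are finitely many.
If a flow uses two actions of one state, its support carries a nonzero circulation. Because no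
transition cycle has negative cost, the flow can be moved along it, without raising the cost, until
an action drops out. Repeating this leaves at most one action per state (`exists_flow_injOn`), and
these actions define `f`. The flux of `ofFun f` lies below this flow, and the difference is a
transition cycle, so the policy costs no more (`cost_ofFun_le`). Paths to the target ensure that
some flow exists (`exists_isFlow`). -/

namespace SSP

variable {S A : Type*} [Fintype S] [Fintype A]

/-- The unique state in which an action is available. -/
noncomputable def owner (I : SSP S A) (a : A) : S := (I.J_unique a).choose

theorem J_owner (I : SSP S A) (a : A) : I.J a (I.owner a) = 1 := (I.J_unique a).choose_spec.1

theorem owner_eq_of_J_eq_one (I : SSP S A) {a : A} {t : S} (h : I.J a t = 1) : I.owner a = t :=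
  ((I.J_unique a).choose_spec.2 t h).symm

open Classical in
theorem J_eq_ite (I : SSP S A) (a : A) (t : S) : I.J a t = if I.owner a = t then 1 else 0 := by
  split_ifs with h
  · rw [← h, I.J_owner]
  · exact (I.J_zero_one a t).resolve_right fun h1 => h (I.owner_eq_of_J_eq_one h1)

theorem trans_nonneg (I : SSP S A) (a : Option A) (t : Option S) : 0 ≤ I.trans a t := by
  cases a <;> cases t <;> simp [trans, I.P_nonneg, I.P_row_sum_le]

/-! ### Decomposition of walks -/

theorem Walk.ext_init {I : SSP S A} {k : ℕ} {w v : I.Walk (k + 1)} (h : w.init = v.init)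
    (ha : w.action (Fin.last k) = v.action (Fin.last k)) (hl : w.last = v.last) : w = v := by
  apply Walk.ext
  · funext i
    refine Fin.lastCases hl (fun j => ?_) i
    exact congrFun (congrArg Walk.state h) j
  · funext i
    refine Fin.lastCases ha (fun j => ?_) i
    exact congrFun (congrArg Walk.action h) j

theorem Walk.exists_snoc {I : SSP S A} {k : ℕ} (w : I.Walk k) {a : Option A} {t : Option S}
    (ha : I.Edge (Sum.inl w.last) (Sum.inr a)) (ht : I.Edge (Sum.inr a) (Sum.inl t)) :
    ∃ v : I.Walk (k + 1), v.init = w ∧ v.action (Fin.last k) = a ∧ v.last = t := by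
  refine ⟨⟨Fin.snoc (α := fun _ => Option S) w.state t,
    Fin.snoc (α := fun _ => Option A) w.action a, fun i => ?_, fun i => ?_⟩, ?_, ?_, ?_⟩
  · refine Fin.lastCases ?_ (fun j => ?_) i
    · simpa [Walk.last] using ha
    · simpa using w.edge_out j
  · refine Fin.lastCases ?_ (fun j => ?_) i
    · simpa using ht
    · rw [Fin.succ_castSucc, Fin.snoc_castSucc, Fin.snoc_castSucc]
      exact w.edge_in j
  · apply Walk.ext <;> funext i <;> simp [Walk.init]
  · simp
  · simp [Walk.last]

theorem sum_walk_succ (I : SSP S A) {k : ℕ} (F : I.Walk k → Option A → Option S → ℝ)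
    (hF : ∀ w a t, F w a t ≠ 0 →
      I.Edge (Sum.inl w.last) (Sum.inr a) ∧ I.Edge (Sum.inr a) (Sum.inl t)) :
    ∑ v : I.Walk (k + 1), F v.init (v.action (Fin.last k)) v.last = ∑ w, ∑ a, ∑ t, F w a t := by
  have h := Fintype.sum_of_injective
    (fun v : I.Walk (k + 1) => (v.init, v.action (Fin.last k), v.last))
    (fun v w h => by
      simp only [Prod.mk.injEq] at h
      exact Walk.ext_init h.1 h.2.1 h.2.2)
    (fun v => F v.init (v.action (Fin.last k)) v.last) (fun p => F p.1 p.2.1 p.2.2)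
    (fun p hp => by
      by_contra h0
      obtain ⟨h1, h2⟩ := hF _ _ _ h0
      obtain ⟨v, hv1, hv2, hv3⟩ := p.1.exists_snoc h1 h2
      exact hp ⟨v, Prod.ext hv1 (Prod.ext hv2 hv3)⟩)
    (fun _ => rfl)
  rw [h, Fintype.sum_prod_type]
  exact Finset.sum_congr rfl fun w _ => Fintype.sum_prod_type _

theorem exists_walk_zero (I : SSP S A) (r : Option S) : ∃ w : I.Walk 0, w.last = r :=
  ⟨⟨fun _ => r, Fin.elim0, fun i => i.elim0, fun i => i.elim0⟩, rfl⟩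

theorem walk_zero_ext {I : SSP S A} {w v : I.Walk 0} (h : w.last = v.last) : w = v := by
  apply Walk.ext
  · funext i
    rw [show i = Fin.last 0 from Fin.ext (by omega)]
    exact h
  · exact Subsingleton.elim _ _

/-! ### Balance equations for the action probabilities -/

namespace Policy

variable {I : SSP S A}

theorem choice_nonneg (Q : I.Policy) {k : ℕ} (w : I.Walk k) (r : Option S) (a : Option A) :
    0 ≤ Q.choice w r a := by
  cases r <;> cases a <;> simp [choice, Q.nonneg]

theorem edge_of_choice_ne_zero (Q : I.Policy) {k : ℕ} (w : I.Walk k) {r : Option S} {a : Option A}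
    (h : Q.choice w r a ≠ 0) : I.Edge (Sum.inl r) (Sum.inr a) := by
  cases r <;> cases a <;> simp_all [choice, Edge]
  exact Q.available _ _ _ _ (lt_of_le_of_ne (Q.nonneg _ _ _ _) (Ne.symm h))

theorem walkProb_nonneg (Q : I.Policy) (s : S) : {k : ℕ} → (w : I.Walk k) → 0 ≤ Q.walkProb s w
  | 0, w => by
    unfold walkProb
    split_ifs <;> norm_num
  | k + 1, w => by
    unfold walkProb
    exact mul_nonneg (mul_nonneg (walkProb_nonneg Q s _) (choice_nonneg _ _ _ _))
      (I.trans_nonneg _ _)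

theorem x_nonneg (Q : I.Policy) (s : S) (k : ℕ) (a : A) : 0 ≤ Q.x s k a :=
  Finset.sum_nonneg fun _ _ => mul_nonneg (Q.walkProb_nonneg s _) (Q.choice_nonneg _ _ _)

open Classical in
theorem sum_J_mul_choice (Q : I.Policy) {k : ℕ} (w : I.Walk k) (r : Option S) (t : S) :
    ∑ a, I.J a t * Q.choice w r (some a) = if r = some t then 1 else 0 := by
  cases r with
  | none => simp [choice]
  | some u =>
    simp only [choice, Option.some.injEq]
    have key : ∀ a, Q.toFun k w u a ≠ 0 → I.owner a = u := fun a ha =>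
      I.owner_eq_of_J_eq_one (Q.available _ _ _ _ (lt_of_le_of_ne (Q.nonneg _ _ _ _) (Ne.symm ha)))
    split_ifs with h
    · subst h
      rw [← Q.row_sum k w u]
      refine Finset.sum_congr rfl fun a _ => ?_
      by_cases ha : Q.toFun k w u a = 0
      · simp [ha]
      · simp [I.J_eq_ite, key a ha]
    · refine Finset.sum_eq_zero fun a _ => ?_
      by_cases ha : Q.toFun k w u a = 0
      · simp [ha]
      · simp [I.J_eq_ite, key a ha, h]

open Classical in
theorem sum_J_mul_x (Q : I.Policy) (s : S) (k : ℕ) (t : S) :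
    ∑ a, I.J a t * Q.x s k a =
      ∑ w : I.Walk k, Q.walkProb s w * if w.last = some t then 1 else 0 := by
  simp only [x, Finset.mul_sum]
  rw [Finset.sum_comm]
  refine Finset.sum_congr rfl fun w _ => ?_
  rw [← Q.sum_J_mul_choice w, Finset.mul_sum]
  exact Finset.sum_congr rfl fun a _ => by ring

open Classical in
theorem sum_J_mul_x_zero (Q : I.Policy) (s t : S) :
    ∑ a, I.J a t * Q.x s 0 a = if t = s then 1 else 0 := by
  rw [sum_J_mul_x]
  obtain ⟨w, hw⟩ := I.exists_walk_zero (some s)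
  rw [Finset.sum_eq_single w]
  · simp [walkProb, hw, eq_comm]
  · intro v _ hv
    have : v.last ≠ some s := fun h => hv (walk_zero_ext (h.trans hw.symm))
    simp [walkProb, this]
  · simp

/-- Both sides are the probability of being in state `t` in period `k + 1`. -/
theorem sum_J_mul_x_succ (Q : I.Policy) (s : S) (k : ℕ) (t : S) :
    ∑ a, I.J a t * Q.x s (k + 1) a = ∑ a, I.P a t * Q.x s k a := by
  classical
  rw [sum_J_mul_x]
  simp only [walkProb]
  rw [I.sum_walk_succ (fun w a r => Q.walkProb s w * Q.choice w w.last a * I.trans a r *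
    if r = some t then 1 else 0)]
  · simp only [mul_ite, mul_one, mul_zero, Finset.sum_ite_eq', Finset.mem_univ, if_true]
    rw [Finset.sum_comm]
    simp only [Fintype.sum_option, trans, mul_zero, Finset.sum_const_zero, zero_add, x,
      Finset.mul_sum]
    exact Finset.sum_congr rfl fun a _ => Finset.sum_congr rfl fun w _ => by ring
  · intro w a r h
    have h1 : Q.choice w w.last a ≠ 0 := fun h0 => h (by simp [h0])
    have h2 : I.trans a r ≠ 0 := fun h0 => h (by simp [h0])
    refine ⟨Q.edge_of_choice_ne_zero w h1, ?_⟩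
    have := lt_of_le_of_ne (I.trans_nonneg a r) (Ne.symm h2)
    cases a <;> exact this

end Policy

/-! ### Flows -/

open Classical in
/-- A flow from `s`: a solution of `(J - P)ᵀ y = e_s`, `y ≥ 0`. -/
def IsFlow (I : SSP S A) (s : S) (y : A → ℝ) : Prop :=
  (∀ a, 0 ≤ y a) ∧
    ∀ t, ∑ a, I.J a t * y a = (if t = s then 1 else 0) + ∑ a, I.P a t * y a

/-- Summing the one-period balance over all periods leaves only the unmatched period `0`, which
supplies the source `e_s`. -/
theorem Policy.IsProper.isFlow_flux {I : SSP S A} {Q : I.Policy} {s : S} (h : Q.IsProper s) :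
    I.IsFlow s (Q.flux s) := by
  classical
  refine ⟨fun a => tsum_nonneg fun k => Q.x_nonneg s k a, fun t => ?_⟩
  have hJ : HasSum (fun k => ∑ a, I.J a t * Q.x s k a) (∑ a, I.J a t * Q.flux s a) :=
    hasSum_sum fun a _ => (h a).hasSum.mul_left _
  have hP : HasSum (fun k => ∑ a, I.P a t * Q.x s k a) (∑ a, I.P a t * Q.flux s a) :=
    hasSum_sum fun a _ => (h a).hasSum.mul_left _
  rw [← hJ.tsum_eq, hJ.summable.tsum_eq_zero_add, Q.sum_J_mul_x_zero]
  simp only [Q.sum_J_mul_x_succ, hP.tsum_eq]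

theorem Assumption.cost_nonneg {I : SSP S A} (hI : I.Assumption) {d : A → ℝ} (h0 : ∀ a, 0 ≤ d a)
    (hd : ∀ t, ∑ a, (I.J a t - I.P a t) * d a = 0) : 0 ≤ ∑ a, I.c a * d a := by
  by_contra hc
  refine hI.2 ⟨d, ⟨?_, h0⟩, not_le.mp hc⟩
  funext t
  simpa [Matrix.mulVec, dotProduct] using hd t

/-- A state with no outflow has no inflow. Hence the equations at states owning no support action
hold trivially for vectors on the support. -/
theorem IsFlow.P_eq_zero {I : SSP S A} {s : S} {y : A → ℝ} (hy : I.IsFlow s y) {t : S}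
    (ht : ∀ a, y a ≠ 0 → I.owner a ≠ t) {a : A} (ha : y a ≠ 0) : I.P a t = 0 := by
  classical
  have h0 : ∑ b, I.J b t * y b = 0 := Finset.sum_eq_zero fun b _ => by
    by_cases hb : y b = 0
    · simp [hb]
    · simp [I.J_eq_ite, ht b hb]
  have h1 := hy.2 t
  have hn : ∀ b ∈ Finset.univ, 0 ≤ I.P b t * y b := fun b _ =>
    mul_nonneg (I.P_nonneg _ _) (hy.1 b)
  have h2 : ∑ b, I.P b t * y b = 0 := by
    have := Finset.sum_nonneg hn
    have h3 : (0 : ℝ) ≤ if t = s then 1 else 0 := by split_ifs <;> norm_num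
    linarith
  have := (Finset.sum_eq_zero_iff_of_nonneg hn).1 h2 a (Finset.mem_univ a)
  exact (mul_eq_zero.1 this).resolve_right ha

/-- Two actions of the same state in the support of a flow give a circulation on the support. -/
theorem IsFlow.exists_circulation {I : SSP S A} {s : S} {y : A → ℝ} (hy : I.IsFlow s y) {a b : A}
    (hab : a ≠ b) (ha : y a ≠ 0) (hb : y b ≠ 0) (ho : I.owner a = I.owner b) :
    ∃ d : A → ℝ, d ≠ 0 ∧ (∀ e, y e = 0 → d e = 0) ∧
      ∀ t, ∑ e, (I.J e t - I.P e t) * d e = 0 := by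
  classical
  let T : Finset A := Finset.univ.filter fun e => y e ≠ 0
  let U : Finset S := T.image I.owner
  -- `a` and `b` share a state, so the homogeneous system has fewer equations than unknowns.
  have hcard : U.card < T.card := by
    refine lt_of_le_of_ne Finset.card_image_le fun h => hab ?_
    exact Finset.card_image_iff.1 h (by simp [T, ha]) (by simp [T, hb]) ho
  let L : (T → ℝ) →ₗ[ℝ] (U → ℝ) :=
    Matrix.mulVecLin (fun (u : U) (e : T) => I.J e u - I.P e u)
  have hker : LinearMap.ker L ≠ ⊥ := by
    apply LinearMap.ker_ne_bot_of_finrank_lt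
    simpa using hcard
  obtain ⟨d, hd, hd0⟩ := Submodule.exists_mem_ne_zero_of_ne_bot hker
  have hsum : ∀ g : A → ℝ, ∑ e, g e * (if h : e ∈ T then d ⟨e, h⟩ else 0) = ∑ e : T, g e * d e := by
    intro g
    rw [← Finset.sum_subset (Finset.subset_univ T) (fun e _ he => by simp [he]),
      ← Finset.sum_coe_sort T]
    exact Finset.sum_congr rfl fun e _ => by simp
  refine ⟨fun e => if h : e ∈ T then d ⟨e, h⟩ else 0, ?_, ?_, ?_⟩
  · intro h
    apply hd0
    funext e
    have := congrFun h e
    simpa using this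
  · intro e he
    simp [T, he]
  · intro t
    rw [hsum fun e => I.J e t - I.P e t]
    by_cases ht : t ∈ U
    · exact congrFun (LinearMap.mem_ker.1 hd) ⟨t, ht⟩
    · have ht' : ∀ e, y e ≠ 0 → I.owner e ≠ t := fun e he h =>
        ht (Finset.mem_image.2 ⟨e, by simp [T, he], h⟩)
      refine Finset.sum_eq_zero fun e _ => ?_
      have he : y e ≠ 0 := (Finset.mem_filter.1 e.2).2
      simp [hy.P_eq_zero ht' he, I.J_eq_ite, ht' e he]

/-- A flow can be moved along a circulation with a negative entry until its support shrinks. -/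
theorem IsFlow.exists_support_ssubset {I : SSP S A} {s : S} {y d : A → ℝ} (hy : I.IsFlow s y)
    (hd : ∀ e, y e = 0 → d e = 0) (hd0 : ∀ t, ∑ e, (I.J e t - I.P e t) * d e = 0)
    (hneg : ∃ e, d e < 0) (hc : ∑ e, I.c e * d e ≤ 0) :
    ∃ z, I.IsFlow s z ∧ ∑ e, I.c e * z e ≤ ∑ e, I.c e * y e ∧
      Function.support z ⊂ Function.support y := by
  classical
  obtain ⟨e₀, he₀⟩ := hneg
  obtain ⟨b, hb, hmin⟩ := Finset.exists_min_image (Finset.univ.filter fun e => d e < 0)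
    (fun e => y e / -d e) ⟨e₀, by simp [he₀]⟩
  simp only [Finset.mem_filter, Finset.mem_univ, true_and] at hb hmin
  -- Ratio test: `r` is the largest step that keeps `y + r d` nonnegative, and it annihilates the
  -- entry at `b`.
  set r := y b / -d b with hr
  have hr0 : 0 ≤ r := div_nonneg (hy.1 b) (by linarith)
  have hzb : y b + r * d b = 0 := by
    rw [hr]
    field_simp [hb.ne]
    ring
  refine ⟨fun e => y e + r * d e, ⟨fun e => ?_, fun t => ?_⟩, ?_, ?_, ?_⟩
  · by_cases he : d e < 0
    · have := hmin e he
      rw [le_div_iff₀ (by linarith)] at this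
      show 0 ≤ y e + r * d e
      linarith
    · exact add_nonneg (hy.1 e) (mul_nonneg hr0 (not_lt.1 he))
  · have h1 := hy.2 t
    have h2 := hd0 t
    simp only [sub_mul, Finset.sum_sub_distrib] at h2
    simp only [mul_add, Finset.sum_add_distrib, mul_left_comm _ r, ← Finset.mul_sum]
    rw [h1, sub_eq_zero.1 h2]
    ring
  · simp only [mul_add, Finset.sum_add_distrib, mul_left_comm _ r, ← Finset.mul_sum]
    have := mul_nonpos_of_nonneg_of_nonpos hr0 hc
    linarith
  · intro e he h0
    exact he (by simp [h0, hd e h0])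
  · intro h
    have : b ∈ Function.support y := fun h0 => hb.ne (hd b h0)
    exact h this hzb

/-- Every flow is dominated by one that uses at most one action in each state. -/
theorem Assumption.exists_flow_injOn {I : SSP S A} (hI : I.Assumption) {s : S} {y : A → ℝ}
    (hy : I.IsFlow s y) :
    ∃ z, I.IsFlow s z ∧ ∑ e, I.c e * z e ≤ ∑ e, I.c e * y e ∧
      Set.InjOn I.owner (Function.support z) := by
  induction hn : (Function.support y).ncard using Nat.strong_induction_on generalizing y with
  | _ n ih =>
  subst hn
  by_cases hinj : Set.InjOn I.owner (Function.support y)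
  · exact ⟨y, hy, le_rfl, hinj⟩
  · have : ∃ a b, y a ≠ 0 ∧ y b ≠ 0 ∧ I.owner a = I.owner b ∧ a ≠ b := by
      simp only [Set.InjOn, not_forall] at hinj
      obtain ⟨a, ha, b, hb, ho, hab⟩ := hinj
      exact ⟨a, b, ha, hb, ho, hab⟩
    obtain ⟨a, b, ha, hb, ho, hab⟩ := this
    obtain ⟨d, hd0, hdy, hdt⟩ := hy.exists_circulation hab ha hb ho
    have hdn : ∀ t, ∑ e, (I.J e t - I.P e t) * (-d) e = 0 := fun t => by
      simpa using hdt t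
    -- If `d` has constant sign, the nonpositive one of `d`, `-d` is the negative of a transition
    -- cycle and cannot raise the cost. Otherwise both have a negative entry and the cheaper one
    -- serves.
    have key : ∃ d' : A → ℝ, (∀ e, y e = 0 → d' e = 0) ∧
        (∀ t, ∑ e, (I.J e t - I.P e t) * d' e = 0) ∧ (∃ e, d' e < 0) ∧
        ∑ e, I.c e * d' e ≤ 0 := by
      have hdny : ∀ e, y e = 0 → (-d) e = 0 := fun e he => by simp [hdy e he]
      have hcn : ∑ e, I.c e * (-d) e = -∑ e, I.c e * d e := by simp
      have hex : ∃ e, d e ≠ 0 := Function.ne_iff.1 hd0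
      by_cases h1 : ∀ e, 0 ≤ d e
      · obtain ⟨e, he⟩ := hex
        refine ⟨-d, hdny, hdn, ⟨e, ?_⟩, ?_⟩
        · simpa using lt_of_le_of_ne (h1 e) (Ne.symm he)
        · rw [hcn]
          linarith [hI.cost_nonneg h1 hdt]
      · by_cases h2 : ∀ e, 0 ≤ (-d) e
        · obtain ⟨e, he⟩ := hex
          refine ⟨d, hdy, hdt, ⟨e, ?_⟩, ?_⟩
          · exact lt_of_le_of_ne (by simpa using h2 e) he
          · linarith [hI.cost_nonneg h2 hdn]
        · push Not at h1 h2
          rcases le_total (∑ e, I.c e * d e) 0 with hc | hc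
          · exact ⟨d, hdy, hdt, h1, hc⟩
          · exact ⟨-d, hdny, hdn, h2, by linarith⟩
    obtain ⟨d', h1, h2, h3, h4⟩ := key
    obtain ⟨z, hz, hzc, hzs⟩ := hy.exists_support_ssubset h1 h2 h3 h4
    obtain ⟨z', hz', hzc', hinj'⟩ := ih _ (Set.ncard_lt_ncard hzs (Set.toFinite _)) hz rfl
    exact ⟨z', hz', hzc'.trans hzc, hinj'⟩

/-! ### Deterministic stationary policies -/

open Classical in
/-- The deterministic stationary policy given by a choice of one available action per state. -/
noncomputable def ofFun (I : SSP S A) (f : S → A) (hf : ∀ t, I.J (f t) t = 1) : I.Policy where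
  toFun _ _ t a := if a = f t then 1 else 0
  nonneg _ _ t a := by split_ifs <;> norm_num
  row_sum _ _ t := by simp
  available _ _ t a h := by
    by_cases ha : a = f t
    · rw [ha, hf]
    · simp [ha] at h

theorem sum_J_mul_of_eq_zero (I : SSP S A) {f : S → A} (hf : ∀ t, I.J (f t) t = 1) {z : A → ℝ}
    (hz : ∀ a, a ≠ f (I.owner a) → z a = 0) (t : S) : ∑ a, I.J a t * z a = z (f t) := by
  classical
  rw [Finset.sum_eq_single (f t)]
  · rw [hf, one_mul]
  · intro a _ ha
    by_cases ho : I.owner a = t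
    · rw [hz a (by rwa [ho]), mul_zero]
    · simp [I.J_eq_ite, ho]
  · simp

theorem ofFun_x_eq_zero (I : SSP S A) {f : S → A} (hf : ∀ t, I.J (f t) t = 1) (s : S) (k : ℕ)
    {a : A} (ha : a ≠ f (I.owner a)) : (I.ofFun f hf).x s k a = 0 := by
  classical
  refine Finset.sum_eq_zero fun w _ => ?_
  suffices h : (I.ofFun f hf).choice w w.last (some a) = 0 by rw [h, mul_zero]
  cases w.last with
  | none => rfl
  | some t =>
    refine if_neg fun h => ha ?_
    rw [I.owner_eq_of_J_eq_one (h ▸ hf t), ← h]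

/-- Induction on the horizon: the first `N + 1` periods satisfy the flow equation with the first `N`
periods on the right, and `P ≥ 0` preserves the bound. -/
theorem IsFlow.sum_range_x_le {I : SSP S A} {s : S} {y : A → ℝ} (hy : I.IsFlow s y) {f : S → A}
    (hf : ∀ t, I.J (f t) t = 1) (hyf : ∀ a, a ≠ f (I.owner a) → y a = 0) (N : ℕ) (a : A) :
    ∑ k ∈ Finset.range N, (I.ofFun f hf).x s k a ≤ y a := by
  classical
  induction N generalizing a with
  | zero => simpa using hy.1 a
  | succ N ih =>
    by_cases ha : a = f (I.owner a)
    · set t := I.owner a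
      have hx : ∀ k, (I.ofFun f hf).x s k a = ∑ b, I.J b t * (I.ofFun f hf).x s k b := fun k => by
        rw [I.sum_J_mul_of_eq_zero hf (fun b hb => I.ofFun_x_eq_zero hf s k hb), ← ha]
      have hya : y a = ∑ b, I.J b t * y b := by rw [I.sum_J_mul_of_eq_zero hf hyf, ← ha]
      rw [hya, hy.2 t, Finset.sum_range_succ', hx 0, Policy.sum_J_mul_x_zero, add_comm]
      simp only [hx, Policy.sum_J_mul_x_succ]
      rw [Finset.sum_comm]
      simp only [← Finset.mul_sum]
      gcongr with b
      · exact I.P_nonneg _ _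
      · exact ih b
    · rw [hyf a ha, Finset.sum_eq_zero fun k _ => I.ofFun_x_eq_zero hf s k ha]

theorem IsFlow.isProper_ofFun {I : SSP S A} {s : S} {y : A → ℝ} (hy : I.IsFlow s y) {f : S → A}
    (hf : ∀ t, I.J (f t) t = 1) (hyf : ∀ a, a ≠ f (I.owner a) → y a = 0) :
    (I.ofFun f hf).IsProper s := fun a =>
  summable_of_sum_range_le (fun k => Policy.x_nonneg _ s k a)
    fun N => hy.sum_range_x_le hf hyf N a

theorem Assumption.cost_ofFun_le {I : SSP S A} (hI : I.Assumption) {s : S} {y : A → ℝ}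
    (hy : I.IsFlow s y) {f : S → A} (hf : ∀ t, I.J (f t) t = 1)
    (hyf : ∀ a, a ≠ f (I.owner a) → y a = 0) :
    (I.ofFun f hf).cost s ≤ ∑ a, I.c a * y a := by
  have hp := hy.isProper_ofFun hf hyf
  have hz := hp.isFlow_flux
  have hle : ∀ a, 0 ≤ y a - (I.ofFun f hf).flux s a := fun a =>
    sub_nonneg.2 ((hp a).tsum_le_of_sum_range_le fun N => hy.sum_range_x_le hf hyf N a)
  have := hI.cost_nonneg hle fun t => by
    have h1 := hy.2 t
    have h2 := hz.2 t
    simp only [mul_sub, sub_mul, Finset.sum_sub_distrib]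
    linarith
  simp only [mul_sub, Finset.sum_sub_distrib] at this
  simp only [Policy.cost, dotProduct]
  linarith

theorem EveryStateReachesTarget.exists_available {I : SSP S A} (h : I.EveryStateReachesTarget)
    (t : S) : ∃ a, I.J a t = 1 := by
  rcases (h t).cases_head with h0 | ⟨v, hv, -⟩
  · simp at h0
  · rcases v with v | _ | a
    · exact hv.elim
    · exact hv.elim
    · exact ⟨a, hv⟩

theorem Assumption.exists_ofFun_cost_le {I : SSP S A} (hI : I.Assumption) {s : S} {y : A → ℝ}
    (hy : I.IsFlow s y) :
    ∃ (f : S → A) (hf : ∀ t, I.J (f t) t = 1), (I.ofFun f hf).IsProper s ∧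
      (I.ofFun f hf).cost s ≤ ∑ a, I.c a * y a := by
  classical
  obtain ⟨z, hz, hzc, hinj⟩ := hI.exists_flow_injOn hy
  have hex : ∀ t, ∃ a, I.J a t = 1 ∧ ∀ b, I.owner b = t → z b ≠ 0 → b = a := by
    intro t
    by_cases h : ∃ a, I.owner a = t ∧ z a ≠ 0
    · obtain ⟨a, rfl, ha⟩ := h
      exact ⟨a, I.J_owner a, fun b hb hzb => hinj hzb ha hb⟩
    -- Where the flow vanishes, any available action will do.
    · obtain ⟨a, ha⟩ := hI.1.exists_available t
      exact ⟨a, ha, fun b hb hzb => (h ⟨b, hb, hzb⟩).elim⟩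
  choose f hf hfz using hex
  have hzf : ∀ a, a ≠ f (I.owner a) → z a = 0 := fun a ha => by
    by_contra h0
    exact ha (hfz _ a rfl h0)
  exact ⟨f, hf, hz.isProper_ofFun hf hzf, (hI.cost_ofFun_le hz hf hzf).trans hzc⟩

/-! ### Existence of a flow -/

/-- The minimum principle for the average over the available actions. -/
theorem EveryStateReachesTarget.nonneg_of_superharmonic {I : SSP S A}
    (h : I.EveryStateReachesTarget) {v : S → ℝ}
    (hv : ∀ t, 0 ≤ ∑ a, I.J a t * (v t - ∑ u, I.P a u * v u)) (t : S) : 0 ≤ v t := by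
  obtain ⟨i, -, hi⟩ := Finset.exists_min_image Finset.univ v ⟨t, Finset.mem_univ t⟩
  refine le_trans ?_ (hi t (Finset.mem_univ t))
  by_contra! hneg
  set m := v i with hm
  have hmin : ∀ u, m ≤ v u := fun u => hi u (Finset.mem_univ u)
  have hstep : ∀ a, m ≤ ∑ u, I.P a u * v u := fun a => by
    calc m ≤ (∑ u, I.P a u) * m := by nlinarith [I.P_row_sum_le a]
      _ = ∑ u, I.P a u * m := Finset.sum_mul ..
      _ ≤ _ := Finset.sum_le_sum fun u _ => mul_le_mul_of_nonneg_left (hmin u) (I.P_nonneg a u)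
  have htight : ∀ a j, I.J a j = 1 → v j = m → ∑ u, I.P a u * v u = m := by
    intro a j ha hj
    have hJ : ∀ b, 0 ≤ I.J b j := fun b => by
      rcases I.J_zero_one b j with h | h <;> simp [h]
    have hle : ∀ b ∈ Finset.univ, 0 ≤ I.J b j * ((∑ u, I.P b u * v u) - v j) := fun b _ =>
      mul_nonneg (hJ b) (by rw [hj]; linarith [hstep b])
    have hsum : ∑ b, I.J b j * ((∑ u, I.P b u * v u) - v j) = 0 := by
      refine le_antisymm ?_ (Finset.sum_nonneg hle)
      have := hv j
      rw [← neg_nonneg, ← Finset.sum_neg_distrib]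
      exact this.trans_eq (Finset.sum_congr rfl fun b _ => by ring)
    have := (Finset.sum_eq_zero_iff_of_nonneg hle).1 hsum a (Finset.mem_univ a)
    rw [ha, one_mul, hj] at this
    linarith
  have hrow : ∀ a, ∑ u, I.P a u * v u = m →
      ∑ u, I.P a u = 1 ∧ ∀ u, 0 < I.P a u → v u = m := by
    intro a ha
    have hn : ∀ u ∈ Finset.univ, 0 ≤ I.P a u * (v u - m) := fun u _ =>
      mul_nonneg (I.P_nonneg a u) (sub_nonneg.2 (hmin u))
    have h0 : ∑ u, I.P a u * (v u - m) = m - (∑ u, I.P a u) * m := by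
      simp only [mul_sub, Finset.sum_sub_distrib, ha, Finset.sum_mul]
    have h1 := Finset.sum_nonneg hn
    -- As `m < 0`, any mass sent to the target would lift the average above `m`.
    have h2 : ∑ u, I.P a u = 1 := by
      refine le_antisymm (I.P_row_sum_le a) ?_
      by_contra! hlt
      nlinarith
    refine ⟨h2, fun u hu => ?_⟩
    rw [h2, one_mul, sub_self] at h0
    have := (Finset.sum_eq_zero_iff_of_nonneg hn).1 h0 u (Finset.mem_univ u)
    rcases mul_eq_zero.1 this with h | h <;> linarith
  -- Attaining the minimum `m` propagates along arcs and excludes the target, contradicting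
  -- reachability.
  let good : Option S ⊕ Option A → Prop := fun x =>
    (∃ j, x = Sum.inl (some j) ∧ v j = m) ∨
      ∃ a, x = Sum.inr (some a) ∧ ∑ u, I.P a u * v u = m
  have hgood : ∀ x, Relation.ReflTransGen I.Edge (Sum.inl (some i)) x → good x := by
    intro x hx
    induction hx with
    | refl => exact Or.inl ⟨i, rfl, rfl⟩
    | tail _ he ih =>
      rename_i p q _
      rcases ih with ⟨j, rfl, hj⟩ | ⟨a, rfl, ha⟩
      · rcases q with q | _ | a
        · exact he.elim
        · exact he.elim
        · exact Or.inr ⟨a, rfl, htight a j he hj⟩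
      · obtain ⟨h1, h2⟩ := hrow a ha
        rcases q with (_ | u) | q
        · simp [Edge, trans, h1] at he
        · exact Or.inl ⟨u, rfl, h2 u he⟩
        · exact he.elim
  rcases hgood _ (h i) with ⟨j, hj, -⟩ | ⟨a, ha, -⟩
  · simp at hj
  · simp at ha

/-- The minimum principle makes `K = Jᵀ(J - P)` invertible with `K⁻¹ ≥ 0`. The flow `J (K⁻¹)ᵀ e_s`
uses all actions of a state equally. -/
theorem EveryStateReachesTarget.exists_isFlow {I : SSP S A} (h : I.EveryStateReachesTarget)
    (s : S) : ∃ y, I.IsFlow s y := by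
  classical
  obtain ⟨K, hKd⟩ : ∃ K : Matrix S S ℝ, ∀ t u, K t u = ∑ a, I.J a t * (I.J a u - I.P a u) :=
    ⟨fun t u => ∑ a, I.J a t * (I.J a u - I.P a u), fun _ _ => rfl⟩
  have hK : ∀ v t, K.mulVec v t = ∑ a, I.J a t * (v t - ∑ u, I.P a u * v u) := by
    intro v t
    simp only [Matrix.mulVec, dotProduct, hKd, Finset.sum_mul]
    rw [Finset.sum_comm]
    refine Finset.sum_congr rfl fun a _ => ?_
    by_cases ha : I.owner a = t
    · subst ha
      simp only [sub_mul, Finset.sum_sub_distrib, I.J_eq_ite,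
        ite_mul, one_mul, zero_mul, Finset.sum_ite_eq, Finset.mem_univ, if_true]
    · simp [I.J_eq_ite a t, ha]
  have hpos : ∀ v, (∀ t, 0 ≤ K.mulVec v t) → ∀ t, 0 ≤ v t := fun v hv =>
    h.nonneg_of_superharmonic fun t => hK v t ▸ hv t
  have hinj : Function.Injective K.mulVec := by
    intro v w hvw
    funext t
    have h1 := hpos (v - w) (fun t => by simp [Matrix.mulVec_sub, hvw]) t
    have h2 := hpos (w - v) (fun t => by simp [Matrix.mulVec_sub, hvw]) t
    simp only [Pi.sub_apply] at h1 h2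
    linarith
  have hunit : IsUnit K := Matrix.mulVec_injective_iff_isUnit.1 hinj
  have hdet : IsUnit K.det := (Matrix.isUnit_iff_isUnit_det K).1 hunit
  have hnonneg : ∀ t u, 0 ≤ K⁻¹ t u := by
    intro t u
    have := hpos (K⁻¹.mulVec (Pi.single u 1)) (fun r => by
      rw [Matrix.mulVec_mulVec, Matrix.mul_nonsing_inv K hdet, Matrix.one_mulVec]
      by_cases hr : r = u
      · subst hr; simp
      · simp [Pi.single_eq_of_ne hr]) t
    simpa using this
  refine ⟨fun a => K⁻¹ s (I.owner a), fun a => hnonneg _ _, fun t => ?_⟩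
  have h1 : (K⁻¹ * K) s t = (1 : Matrix S S ℝ) s t := by rw [Matrix.nonsing_inv_mul K hdet]
  have h2 : (K⁻¹ * K) s t = ∑ a, (I.J a t - I.P a t) * K⁻¹ s (I.owner a) := by
    simp only [Matrix.mul_apply, hKd, Finset.mul_sum]
    rw [Finset.sum_comm]
    refine Finset.sum_congr rfl fun a _ => ?_
    simp [I.J_eq_ite a, mul_comm]
  rw [h2, Matrix.one_apply] at h1
  simp only [sub_mul, Finset.sum_sub_distrib, eq_comm (a := s)] at h1
  linarith

end SSP

theorem mainTheorem2 {S A : Type*} [Fintype S] [Fintype A] (I : SSP S A)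
    (hI : I.Assumption) (s : S) :
    ∃ Q : I.Policy, Q.IsOptimal s ∧ Q.IsProper s ∧ Q.IsDeterministic ∧ Q.IsStationary := by
  classical
  let F := {f : S → A // ∃ hf : ∀ t, I.J (f t) t = 1, (I.ofFun f hf).IsProper s}
  obtain ⟨y, hy⟩ := hI.1.exists_isFlow s
  obtain ⟨f₀, hf₀, hp₀, -⟩ := hI.exists_ofFun_cost_le hy
  have : Nonempty F := ⟨⟨f₀, hf₀, hp₀⟩⟩
  -- Only finitely many `f` compete, so a cheapest one exists.
  obtain ⟨⟨f, hf, hp⟩, hmin⟩ :=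
    Finite.exists_min fun g : F => (I.ofFun g.1 g.2.choose).cost s
  refine ⟨I.ofFun f hf, ⟨hp, fun R hR => ?_⟩, hp, fun _ _ t a => ?_,
    fun t a => if a = f t then 1 else 0, fun _ _ => rfl⟩
  · obtain ⟨g, hg, hgp, hgc⟩ := hI.exists_ofFun_cost_le hR.isFlow_flux
    exact (hmin ⟨g, hg, hgp⟩).trans hgc
  · by_cases h : a = f t
    · exact Or.inr (if_pos h)
    · exact Or.inl (if_neg h)
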